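/- Let $\mathbb K=\mathbb Q(i)$ or $\mathbb Q(\omega)$ ($\omega$ a primitive cube root of unity), let $\mathbb L/\mathbb K$ be a cyclic Galois extension of degree $n$, with $\mathbb L\subset\mathbb C$ and with Galois group generated by $\sigma$, and let $\gamma\in\mathcal O_{\mathbb K}$ be such that none of $\gamma,\gamma^2,\ldots,\gamma^{n-1}$ is the norm of an element of $\mathbb L$. For $x=(x_0,\ldots,x_{n-1})\in\mathcal O_{\mathbb L}^n$ let $\mathbf X(x)$ be the $n\times n$ matrix whose entry in row $m$ and column $j$ ($0\le m,j\le n-1$) is $\sigma^m(x_{j-m})$ if $j\ge m$ and $\gamma\,\sigma^m(x_{n+j-m})$ if $j<m$. For an ideal $\mathfrak J$ of $\mathcal O_{\mathbb L}$ put $\mathcal C_{\mathfrak J}=\{\mathbf X(x): x_0,\ldots,x_{n-1}\in\mathfrak J\}$. Let $\mathfrak I$ be a non-principal ideal of $\mathcal O_{\mathbb L}$, let $\mathfrak q_1,\ldots,\mathfrak q_K$ be pairwise relatively prime ideals of $\mathcal O_{\mathbb L}$, each relatively prime to $\mathfrak I$, and put $\mathfrak q=\mathfrak q_1\cdots\mathfrak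 q_K$. By the second isomorphism theorem and the Chinese remainder theorem, $x\mapsto(x \bmod \mathfrak q_k)_k$ induces an isomorphism $\mathfrak I/\mathfrak I\mathfrak q\cong\prod_{k}\mathcal O_{\mathbb L}/\mathfrak q_k$. Let $\mathcal M:\prod_k\mathcal O_{\mathbb L}/\mathfrak q_k\to\mathfrak I$ be its inverse followed by the choice of a complete set of coset leaders of $\mathfrak I/\mathfrak I\mathfrak q$. The layered space-time index code (LSTIC) encodes messages $w_k=(w_{k,0},\ldots,w_{k,n-1})\in(\mathcal O_{\mathbb L}/\mathfrak q_k)^n$, $k=1,\ldots,K$, into $\mathbf X(x)$ with $x_\ell=\mathcal M(w_{1,\ell},\ldots,w_{K,\ell})$. Let $\mathcal C$ be the set of all these codewords, and for $\mathcal S\subseteq\{1,\ldots,K\}$ and given values $v_s$, $s\in\mathcal S$, let $\mathcal C_{\mathcal S}$ be the set of the codewords with $w_s=v_s$ for all $s\in\mathcal S$. As usual for codes carved from a lattice, the minimum determinant is that of the underlying (translated) lattice: for $\mathcal D=\mathcal C$ or $\mathcal D=\mathcal C_{\mathcal S}$, $$\delta(\mathcal D)=\min\{\det\big((\mathbf X-\mathbf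 X')(\mathbf X-\mathbf X')^\dagger\big): \mathbf X\ne\mathbf X',\ \mathbf X,\mathbf X'\in\mathcal D+\mathcal C_{\mathfrak I\mathfrak q}\}$$ (for $\mathcal D=\mathcal C$ one has $\mathcal D+\mathcal C_{\mathfrak I\mathfrak q}=\mathcal C_{\mathfrak I}$). The rate of $w_k$ is $R_k=\frac1{2n^2}\log_2|(\mathcal O_{\mathbb L}/\mathfrak q_k)^n|$ bits per real symbol, $R_{\mathcal S}=\sum_{s\in\mathcal S}R_s$, and the normalized side information gain is $$\Gamma(\mathcal C,\mathcal S)=\frac{10\log_{10}\big(\delta(\mathcal C_{\mathcal S})/\delta(\mathcal C)\big)}{n\,R_{\mathcal S}}.$$ Theorem. All these minima exist, and $\delta(\mathcal C)>0$. For every $\mathcal S\subseteq\{1,\ldots,K\}$ with $R_{\mathcal S}>0$ and all values $v_s$, $s\in\mathcal S$, $$\Gamma(\mathcal C,\mathcal S)\ \ge\ 20\log_{10}2+\gamma_{\mathfrak I}\ \ge\ 6+\gamma_{\mathfrak I}\quad\text{dB/bits per real symbol},$$ where $$\gamma_{\mathfrak I}=20\log_{10}\left(\frac{N(\mathfrak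 I)}{\min_{0\ne x\in\mathfrak I}N_{\mathbb L/\mathbb Q}(x)}\right)$$ is negative, and depends only on $\mathfrak I$ and not on $\mathcal S$. -/

import Mathlib

open scoped NumberField

noncomputable section

namespace LSTIC

/-! ### Codeword matrices of the cyclic algebra `(L/K, σ, γ)` -/

section Codes

variable {K L : Type*} [Field K] [Field L] [Algebra K L] {n : ℕ}

/-- The `n × n` matrix of `x₀ + x₁ e + ⋯ + x_{n-1} e^{n-1}`, with complex entries through a fixed
embedding `ι : L → ℂ`. Row `m` (counted from `0`) is
`(γ σ^m(x_{n-m}), …, γ σ^m(x_{n-1}), σ^m(x_0), …, σ^m(x_{n-1-m}))`;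
the subtraction `j - m` of indices in `Fin n` is modulo `n`. -/
def codeword (ι : L →+* ℂ) (σ : L ≃ₐ[K] L) (γ : 𝓞 K) (x : Fin n → 𝓞 L) :
    Matrix (Fin n) (Fin n) ℂ :=
  Matrix.of fun m j =>
    ι ((if j < m then algebraMap K L (γ : K) else 1) * (σ ^ (m : ℕ)) (x (j - m) : L))

/-- The lattice code `C_J` of an ideal `J`: all codeword matrices with every layer in `J`. -/
def idealCode (n : ℕ) (ι : L →+* ℂ) (σ : L ≃ₐ[K] L) (γ : 𝓞 K) (J : Ideal (𝓞 L)) :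
    Set (Matrix (Fin n) (Fin n) ℂ) :=
  {X | ∃ x : Fin n → 𝓞 L, (∀ l, x l ∈ J) ∧ X = codeword ι σ γ x}

/-- The values `det ((X - X') (X - X')ᴴ)` for distinct members `X`, `X'` of a set of matrices
(each of these determinants is a real number). -/
def detValues (C : Set (Matrix (Fin n) (Fin n) ℂ)) : Set ℝ :=
  {d | ∃ X ∈ C, ∃ X' ∈ C, X ≠ X' ∧ (d : ℂ) = ((X - X') * (X - X').conjTranspose).det}

/-- The minimum determinant of a set of matrices. -/
def minDet (C : Set (Matrix (Fin n) (Fin n) ℂ)) : ℝ :=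
  sInf (detValues C)

end Codes

/-! ### The encoding of the messages -/

section Encoding

variable {L : Type*} [Field L] {κ : ℕ}

/-- `I 𝔮` with `𝔮 = 𝔮₁ ⋯ 𝔮_κ`, as a submodule of `I`. -/
def shaping (I : Ideal (𝓞 L)) (q : Fin κ → Ideal (𝓞 L)) : Submodule (𝓞 L) I :=
  Submodule.comap (Submodule.subtype I) (I * ∏ k, q k)

/-- The residues `(x mod 𝔮₁, …, x mod 𝔮_κ)` of an element `x` of `I`. -/
def residues (I : Ideal (𝓞 L)) (q : Fin κ → Ideal (𝓞 L)) :
    I →ₗ[𝓞 L] ((k : Fin κ) → 𝓞 L ⧸ q k) :=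
  LinearMap.pi fun k => (q k).mkQ.comp (Submodule.subtype I)

theorem ker_residues (I : Ideal (𝓞 L)) (q : Fin κ → Ideal (𝓞 L))
    (hq : Pairwise fun i j => IsCoprime (q i) (q j)) (hI : ∀ k, IsCoprime I (q k)) :
    LinearMap.ker (residues I q) = shaping I q := by
  have h1 : IsCoprime I (∏ k, q k) := IsCoprime.prod_right fun k _ => hI k
  have h2 : ∏ k, q k = ⨅ k, q k := by
    simpa using Ideal.prod_eq_iInf_of_pairwise_isCoprime (s := Finset.univ) (J := q)
      fun i _ j _ h => hq h
  ext x
  simp only [shaping, LinearMap.mem_ker, Submodule.mem_comap, Ideal.mul_eq_inf_of_isCoprime h1]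
  simp [h2, residues, funext_iff, Submodule.mem_iInf, Ideal.Quotient.eq_zero_iff_mem]

theorem residues_surjective (I : Ideal (𝓞 L)) (q : Fin κ → Ideal (𝓞 L))
    (hq : Pairwise fun i j => IsCoprime (q i) (q j)) (hI : ∀ k, IsCoprime I (q k)) :
    Function.Surjective (residues I q) := by
  intro w
  have h1 : IsCoprime I (∏ k, q k) := IsCoprime.prod_right fun k _ => hI k
  obtain ⟨a, ha⟩ := Ideal.pi_quotient_surjective hq w
  obtain ⟨i, hi, j, hj, hij⟩ := Ideal.isCoprime_iff_exists.1 h1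
  refine ⟨⟨i * a, I.mul_mem_right a hi⟩, ?_⟩
  funext k
  have hk : j ∈ q k := Ideal.prod_le_inf.trans (Finset.inf_le (Finset.mem_univ k)) hj
  rw [← ha k]
  change Ideal.Quotient.mk (q k) (i * a) = Ideal.Quotient.mk (q k) a
  rw [Ideal.Quotient.eq]
  have : i * a - a = -(a * j) := by linear_combination a * hij
  rw [this]
  exact neg_mem ((q k).mul_mem_left a hk)

/-- The isomorphism `I/I𝔮 ≅ 𝓞_L/𝔮₁ × ⋯ × 𝓞_L/𝔮_κ` which the second isomorphism theorem and the
Chinese remainder theorem give: the class of `x ∈ I` goes to the residues of `x`. -/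
def layerEquiv (I : Ideal (𝓞 L)) (q : Fin κ → Ideal (𝓞 L))
    (hq : Pairwise fun i j => IsCoprime (q i) (q j)) (hI : ∀ k, IsCoprime I (q k)) :
    (I ⧸ shaping I q) ≃ₗ[𝓞 L] ((k : Fin κ) → 𝓞 L ⧸ q k) :=
  (Submodule.quotEquivOfEq _ _ (ker_residues I q hq hI).symm).trans
    ((residues I q).quotKerEquivOfSurjective (residues_surjective I q hq hI))

/-- The layers of the codeword of the messages `w₁, …, w_κ`. The message `w_k` consists of `n`
sub-messages `w_{k,l} ∈ 𝓞_L/𝔮_k`, and layer `l` carries the coset leader (chosen by `leader`) of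
the class in `I/I𝔮` that corresponds to `(w_{1,l}, …, w_{κ,l})`. -/
def layers {n : ℕ} (I : Ideal (𝓞 L)) (q : Fin κ → Ideal (𝓞 L))
    (hq : Pairwise fun i j => IsCoprime (q i) (q j)) (hI : ∀ k, IsCoprime I (q k))
    (leader : I ⧸ shaping I q → I) (w : (k : Fin κ) → Fin n → 𝓞 L ⧸ q k) : Fin n → 𝓞 L :=
  fun l => (leader ((layerEquiv I q hq hI).symm fun k => w k l) : 𝓞 L)

variable {K : Type*} [Field K] [Algebra K L]

/-- The codebook: the codewords of all message tuples. -/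
def codebook (n : ℕ) (ι : L →+* ℂ) (σ : L ≃ₐ[K] L) (γ : 𝓞 K) (I : Ideal (𝓞 L))
    (q : Fin κ → Ideal (𝓞 L)) (hq : Pairwise fun i j => IsCoprime (q i) (q j))
    (hI : ∀ k, IsCoprime I (q k)) (leader : I ⧸ shaping I q → I) :
    Set (Matrix (Fin n) (Fin n) ℂ) :=
  {X | ∃ w : (k : Fin κ) → Fin n → 𝓞 L ⧸ q k,
    X = codeword ι σ γ (layers I q hq hI leader w)}

/-- The subcode left to a receiver that knows `w_s = v_s` for all `s ∈ S`. -/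
def subcode {n : ℕ} (ι : L →+* ℂ) (σ : L ≃ₐ[K] L) (γ : 𝓞 K) (I : Ideal (𝓞 L))
    (q : Fin κ → Ideal (𝓞 L)) (hq : Pairwise fun i j => IsCoprime (q i) (q j))
    (hI : ∀ k, IsCoprime I (q k)) (leader : I ⧸ shaping I q → I)
    (S : Finset (Fin κ)) (v : (k : Fin κ) → Fin n → 𝓞 L ⧸ q k) :
    Set (Matrix (Fin n) (Fin n) ℂ) :=
  {X | ∃ w : (k : Fin κ) → Fin n → 𝓞 L ⧸ q k, (∀ s ∈ S, w s = v s) ∧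
    X = codeword ι σ γ (layers I q hq hI leader w)}

/-- The (translate of a) lattice from which a set `C` of codewords is carved: `C + C_{I𝔮}`, where
only the class of each layer modulo the shaping lattice `I𝔮` matters. The minimum determinant of a
code carved from a lattice is, by convention, that of the lattice. -/
def periodic {n : ℕ} (ι : L →+* ℂ) (σ : L ≃ₐ[K] L) (γ : 𝓞 K) (I : Ideal (𝓞 L))
    (q : Fin κ → Ideal (𝓞 L)) (C : Set (Matrix (Fin n) (Fin n) ℂ)) :
    Set (Matrix (Fin n) (Fin n) ℂ) :=
  {Z | ∃ X ∈ C, ∃ Y ∈ idealCode n ι σ γ (I * ∏ k, q k), Z = X + Y}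

end Encoding

/-! ### Rates, side information gain, and the constant `γ_I` -/

section Gain

variable {L : Type*} [Field L] {κ : ℕ}

/-- The rate, in bits per real symbol, of a message with values in `(𝓞_L/𝔮_k)^n`; an `n × n`
complex codeword carries `2 n²` real symbols. -/
def messageRate (n : ℕ) (qk : Ideal (𝓞 L)) : ℝ :=
  Real.logb 2 (Nat.card (Fin n → 𝓞 L ⧸ qk)) / (2 * (n : ℝ) ^ 2)

/-- The rate of the side information `w_S`. -/
def sideInfoRate (n : ℕ) (q : Fin κ → Ideal (𝓞 L)) (S : Finset (Fin κ)) : ℝ :=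
  ∑ s ∈ S, messageRate n (q s)

/-- The normalized side information gain, in dB per bit per real symbol, for `n` transmit antennas,
a code carved from `C` which side information of rate `R` reduces to one carved from `CS`. -/
def gain {n : ℕ} (C CS : Set (Matrix (Fin n) (Fin n) ℂ)) (R : ℝ) : ℝ :=
  10 * Real.logb 10 (minDet CS / minDet C) / (n * R)

/-- The norms `N_{L/ℚ}(x)` of the nonzero elements `x` of `I`. -/
def normValues [NumberField L] (I : Ideal (𝓞 L)) : Set ℝ :=
  {m | ∃ x ∈ I, x ≠ 0 ∧ m = (Algebra.norm ℚ (x : L) : ℝ)}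

/-- `γ_I = 20 log₁₀ (N(I) / min_{0 ≠ x ∈ I} N_{L/ℚ}(x))`. -/
def gammaI [NumberField L] (I : Ideal (𝓞 L)) : ℝ :=
  20 * Real.logb 10 ((Ideal.absNorm I : ℝ) / sInf (normValues I))

end Gain

end LSTIC

end

namespace LSTIC

/-! ### Norms from a cyclic extension and semilinear maps. -/

section Cyclic

variable {K L : Type*} [Field K] [Field L] [Algebra K L]

/-! A codeword is the matrix of right multiplication by `x` in the cyclic algebra `(L/K, σ, γ)`, so
its determinant is a reduced norm `d ∈ 𝓞 K`, and the Gram determinant is `|d|² = N(d)`. By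
Wedderburn's criterion (`det_layerMatrix_ne_zero`) the algebra is a division algebra, hence `d ≠ 0`
for `x ≠ 0`.

If all layers lie in an ideal `J`, then row `m` of the matrix lies in `σ^m(J)`, so `d ∈ ∏ σ^m(J)`.
Taking norms in `L` gives `N(J)^n ∣ N(d)^n`, hence `N(J) ∣ N(d)` (`exists_det_eq_algebraMap`).
Differences in the subcode have layers in `J = I ∏_{s ∈ S} 𝔮_s`, so `δ(C_S) ≥ N(I) Q` with `Q =
N(∏_{s ∈ S} 𝔮_s)`. In the other direction, a codeword with one nonzero layer `x ∈ I` has Gram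
determinant `N_{L/ℚ}(x)`, so `δ(C) ≤ M`, the least such norm.

Since `n R_S = ½ log₂ Q`, the gain is at least `20 log₁₀ 2 + (20 / log₂ Q) log₁₀(N(I)/M)`. The last
logarithm is negative because `I` is not principal, and `log₂ Q ≥ 1`, so replacing `20 / log₂ Q` by
`20` only lowers the bound (`gain_lower_bound`). -/

theorem algebraMap_norm_eq_prod_range [FiniteDimensional K L] [IsGalois K L] {n : ℕ}
    (hn : Module.finrank K L = n) (σ : L ≃ₐ[K] L) (hσ : ∀ τ : L ≃ₐ[K] L, τ ∈ Subgroup.zpowers σ)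
    (y : L) : algebraMap K L (Algebra.norm K y) = ∏ i ∈ Finset.range n, (σ ^ i) y := by
  classical
  have ho : orderOf σ = n := by
    rw [← hn, ← IsGalois.card_aut_eq_finrank, ← Nat.card_zpowers,
      (Subgroup.eq_top_iff' _).2 hσ, Subgroup.card_top]
  rw [Algebra.norm_eq_prod_automorphisms, ← IsCyclic.image_range_orderOf hσ, ho,
    Finset.prod_image]
  intro a ha b hb h
  refine pow_injOn_Iio_orderOf ?_ ?_ h
  · simpa [ho] using ha
  · simpa [ho] using hb

theorem pow_finrank_eq_one [FiniteDimensional K L] [IsGalois K L] {n : ℕ}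
    (hn : Module.finrank K L = n) (σ : L ≃ₐ[K] L) : σ ^ n = 1 := by
  rw [← hn, ← IsGalois.card_aut_eq_finrank, pow_card_eq_one']

/-- If the `n`-th iterate of a `σ`-semilinear endomorphism is multiplication by `γ`, then
`γ ^ dim V` is a norm. -/
theorem exists_norm_eq_pow_finrank [FiniteDimensional K L] [IsGalois K L] {n : ℕ}
    (hn : Module.finrank K L = n) (σ : L ≃ₐ[K] L) (hσ : ∀ τ : L ≃ₐ[K] L, τ ∈ Subgroup.zpowers σ)
    (γ : K) {V : Type*} [AddCommGroup V] [Module L V] [FiniteDimensional L V]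
    (φ : V →+ V) (hφ : ∀ (c : L) v, φ (c • v) = σ c • φ v)
    (hγ : ∀ v, φ^[n] v = algebraMap K L γ • v) :
    ∃ y : L, Algebra.norm K y = γ ^ Module.finrank L V := by
  let b := Module.finBasis L V
  let Q : ℕ → Matrix (Fin (Module.finrank L V)) (Fin (Module.finrank L V)) L :=
    fun r => Matrix.of fun i j => b.repr (φ^[r] (b j)) i
  -- Semilinearity twists the coefficients of each further factor by `σ`, so `det (Q n)` is the
  -- product of the conjugates of `det (Q 1)`, that is, its norm. But `Q n` is scalar multiplication
  -- by `γ`.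
  have hQ : ∀ r, Q (r + 1) = Q 1 * (Q r).map σ := by
    intro r
    ext i j
    simp only [Q, Matrix.of_apply, Matrix.mul_apply, Matrix.map_apply, Function.iterate_succ',
      Function.comp_apply, Function.iterate_zero, id_eq]
    nth_rewrite 1 [← b.sum_repr (φ^[r] (b j))]
    simp only [map_sum, hφ, map_smul, Finsupp.coe_finsetSum, Finset.sum_apply,
      Finsupp.smul_apply, smul_eq_mul, mul_comm]
  have hdet : ∀ r, (Q r).det = ∏ i ∈ Finset.range r, (σ ^ i) (Q 1).det := by
    intro r
    induction r with
    | zero =>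
      have : Q 0 = 1 := by
        ext i j
        simp [Q, Matrix.one_apply, Finsupp.single_apply, eq_comm]
      simp [this]
    | succ r ih =>
      have h : ((Q r).map σ).det = σ (Q r).det := (AlgEquiv.map_det σ (Q r)).symm
      rw [hQ, Matrix.det_mul, h, ih, Finset.prod_range_succ', map_prod, mul_comm]
      simp [pow_succ']
  refine ⟨(Q 1).det, (algebraMap K L).injective ?_⟩
  rw [algebraMap_norm_eq_prod_range hn σ hσ, ← hdet]
  have : Q n = algebraMap K L γ • (1 : Matrix _ _ L) := by
    ext i j
    simp only [Q, hγ, Matrix.of_apply, map_smul, Finsupp.smul_apply, Module.Basis.repr_self,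
      Finsupp.single_apply, Matrix.smul_apply, Matrix.one_apply, eq_comm]
  rw [this, Matrix.det_smul]
  simp

end Cyclic

/-! ### The cyclic algebra in coordinates, and Wedderburn's criterion. -/

section LayerMatrix

variable {K L : Type*} [Field K] [Field L] [Algebra K L]

/-- The matrix of right multiplication by `x₀ + x₁ e + ⋯` in the cyclic algebra `(L/K, σ, γ)`,
in the basis `1, e, …, e ^ (n - 1)` of the left `L`-vector space. -/
def layerMatrix {n : ℕ} (σ : L ≃ₐ[K] L) (γ : K) (x : Fin n → L) : Matrix (Fin n) (Fin n) L :=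
  Matrix.of fun m j => (if j < m then algebraMap K L γ else 1) * (σ ^ (m : ℕ)) (x (j - m))

theorem fin_val_sub_one {k : ℕ} {j : Fin (k + 1)} (hj : j ≠ 0) : (j - 1).val = j.val - 1 := by
  rcases k with _ | k
  · exact absurd (Fin.fin_one_eq_zero j) hj
  have h1 : (1 : Fin (k + 2)) ≤ j := Fin.one_le_of_ne_zero hj
  rw [Fin.sub_val_of_le h1, Fin.val_one]

theorem fin_zero_sub_one {k : ℕ} : (0 - 1 : Fin (k + 1)) = Fin.last k := by
  rw [sub_eq_iff_eq_add]; simp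

/-- The left multiplication by `e` in the cyclic algebra, in coordinates. -/
def shift {k : ℕ} (σ : L ≃ₐ[K] L) (γ : K) : (Fin (k + 1) → L) →+ (Fin (k + 1) → L) where
  toFun v j := (if j = 0 then algebraMap K L γ else 1) * σ (v (j - 1))
  map_zero' := by ext; simp
  map_add' v w := by ext; simp [mul_add]

theorem shift_apply {k : ℕ} (σ : L ≃ₐ[K] L) (γ : K) (v : Fin (k + 1) → L) (j : Fin (k + 1)) :
    shift σ γ v j = (if j = 0 then algebraMap K L γ else 1) * σ (v (j - 1)) := rfl

theorem shift_smul {k : ℕ} (σ : L ≃ₐ[K] L) (γ : K) (c : L) (v : Fin (k + 1) → L) :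
    shift σ γ (c • v) = σ c • shift σ γ v := by
  ext j
  simp only [shift_apply, Pi.smul_apply, smul_eq_mul, map_mul]
  ring

/-- Exactly the coordinates that have wrapped past the last index carry `γ`. The bound on `r`
excludes a second wrap, which would produce `γ²`. -/
theorem iterate_shift_apply {k : ℕ} (σ : L ≃ₐ[K] L) (γ : K) (v : Fin (k + 1) → L) (r : ℕ)
    (hr : r ≤ k + 1) (j : Fin (k + 1)) :
    (shift σ γ)^[r] v j =
      (if j.val < r then algebraMap K L γ else 1) * (σ ^ r) (v (j - r • 1)) := by
  induction r generalizing j with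
  | zero => simp
  | succ r ih =>
    rw [Function.iterate_succ_apply', shift_apply, ih (by omega), map_mul, ← mul_assoc]
    congr 1
    · rcases eq_or_ne j 0 with rfl | hj
      · rw [fin_zero_sub_one]
        simp [show ¬ k < r by omega]
      · have hj' : j.val ≠ 0 := fun h => hj (Fin.ext h)
        rw [fin_val_sub_one hj]
        by_cases h : j.val < r + 1
        · simp [hj, h, show j.val - 1 < r by omega]
        · simp [hj, h, show ¬ j.val - 1 < r by omega]
    · rw [pow_succ', AlgEquiv.mul_apply]
      congr 3
      rw [succ_nsmul]
      abel

theorem iterate_shift_eq_smul {k : ℕ} (σ : L ≃ₐ[K] L) (hσ : σ ^ (k + 1) = 1) (γ : K)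
    (v : Fin (k + 1) → L) : (shift σ γ)^[k + 1] v = algebraMap K L γ • v := by
  ext j
  rw [iterate_shift_apply σ γ v _ le_rfl, hσ]
  have : (k + 1) • (1 : Fin (k + 1)) = 0 := by
    simpa using card_nsmul_eq_zero (x := (1 : Fin (k + 1)))
  rw [this]
  simp [show j.val < k + 1 from j.isLt, -Order.lt_add_one_iff]

/-- Row `m` holds the coordinates of `e^m x`, so this is `e · (e^m x) = e^(m+1) x`. After the last
row comes `γ` times row `0`, since `e^n = γ` and `σ^n = 1`. -/
theorem shift_layerMatrix_row {k : ℕ} (σ : L ≃ₐ[K] L) (hσ : σ ^ (k + 1) = 1) (γ : K)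
    (x : Fin (k + 1) → L) (m j : Fin (k + 1)) :
    (if j = 0 then algebraMap K L γ else 1) * σ (layerMatrix σ γ x m (j - 1)) =
      (if m + 1 = 0 then algebraMap K L γ else 1) * layerMatrix σ γ x (m + 1) j := by
  simp only [layerMatrix, Matrix.of_apply, map_mul, ← mul_assoc]
  have hidx : j - 1 - m = j - (m + 1) := by abel
  by_cases hm : m + 1 = 0
  · have hml : m = Fin.last k := by rw [eq_neg_of_add_eq_zero_left hm, ← fin_zero_sub_one, zero_sub]
    congr 1
    · rcases eq_or_ne j 0 with rfl | hj
      · rw [fin_zero_sub_one]; simp [hml]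
      · have hj' : j.val ≠ 0 := fun h => hj (Fin.ext h)
        have : j - 1 < m := by
          rw [Fin.lt_def, fin_val_sub_one hj, hml, Fin.val_last]; omega
        simp [hj, hm, this]
    · rw [hidx, hm, hml]
      rw [Fin.val_last, ← AlgEquiv.mul_apply, ← pow_succ', hσ]
      simp
  · have hmv : (m + 1).val = m.val + 1 := by
      have := fin_val_sub_one hm
      have h0 : 0 < (m + 1).val := Nat.pos_of_ne_zero fun h => hm (Fin.ext h)
      rw [add_sub_cancel_right] at this
      generalize (m + 1).val = a at *
      omega
    congr 1
    · rcases eq_or_ne j 0 with rfl | hj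
      · have h1 : ¬ Fin.last k < m := by simp [Fin.le_last]
        have h2 : 0 < m + 1 := Fin.pos_iff_ne_zero.2 hm
        rw [fin_zero_sub_one]; simp [hm, h1, h2]
      · have hj' : j.val ≠ 0 := fun h => hj (Fin.ext h)
        have : j - 1 < m ↔ j < m + 1 := by
          rw [Fin.lt_def, Fin.lt_def, fin_val_sub_one hj, hmv]; omega
        by_cases h : j < m + 1
        · simp [hj, hm, this.2 h, h]
        · simp [hj, hm, mt this.1 h, h]
    · rw [hidx, hmv, pow_succ', AlgEquiv.mul_apply]

/-- Associativity `e (v x) = (e v) x`: left multiplication by `e` commutes with right multiplication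
by `x`. -/
theorem shift_vecMul {k : ℕ} (σ : L ≃ₐ[K] L) (hσ : σ ^ (k + 1) = 1) (γ : K)
    (x v : Fin (k + 1) → L) :
    shift σ γ (Matrix.vecMul v (layerMatrix σ γ x)) =
      Matrix.vecMul (shift σ γ v) (layerMatrix σ γ x) := by
  ext j
  simp only [shift_apply, Matrix.vecMul, dotProduct, map_sum, map_mul, Finset.mul_sum]
  rw [← Equiv.sum_comp (Equiv.addRight (1 : Fin (k + 1)))
    (fun m => (if m = 0 then algebraMap K L γ else 1) * σ (v (m - 1)) * layerMatrix σ γ x m j)]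
  refine Finset.sum_congr rfl fun m _ => ?_
  have := shift_layerMatrix_row σ hσ γ x m j
  simp only [Equiv.coe_addRight, add_sub_cancel_right]
  rw [mul_left_comm, this, mul_left_comm, ← mul_assoc]
  congr

/-- By `shift_layerMatrix_row`, shifting the columns of `σ(A)` cyclically and scaling one by `γ`
gives the same matrix as shifting the rows of `A` and scaling one by `γ`. The signs of the two
shifts agree, and the two factors `γ` cancel. -/
theorem map_det_layerMatrix {k : ℕ} (σ : L ≃ₐ[K] L) (hσ : σ ^ (k + 1) = 1) {γ : K} (hγ : γ ≠ 0)
    (x : Fin (k + 1) → L) : σ (layerMatrix σ γ x).det = (layerMatrix σ γ x).det := by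
  set A := layerMatrix σ γ x
  let e : Equiv.Perm (Fin (k + 1)) := Equiv.addRight 1
  have hrow : Matrix.of (fun m j => (if j = 0 then algebraMap K L γ else 1) *
      ((A.map σ).submatrix id e.symm) m j) =
      Matrix.of (fun m j => (if e m = 0 then algebraMap K L γ else 1) * (A.submatrix e id) m j) := by
    ext m j
    simp only [e, Matrix.of_apply, Matrix.submatrix_apply, Matrix.map_apply, id_eq,
      Equiv.addRight_symm, Equiv.coe_addRight, ← sub_eq_add_neg]
    exact shift_layerMatrix_row σ hσ γ x m j
  have hdet := congrArg Matrix.det hrow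
  rw [Matrix.det_mul_row, Matrix.det_mul_column, Matrix.det_permute', Matrix.det_permute] at hdet
  have h : (A.map σ).det = σ A.det := (AlgEquiv.map_det σ A).symm
  have hp : ∏ m, (if e m = 0 then algebraMap K L γ else 1) = algebraMap K L γ := by
    rw [Equiv.prod_comp e (fun m => if m = 0 then algebraMap K L γ else 1)]; simp
  have hγ' : algebraMap K L γ ≠ 0 := by simpa using hγ
  rw [hp, h] at hdet
  simp only [Finset.prod_ite_eq', Finset.mem_univ, if_true, Equiv.Perm.sign_symm] at hdet
  have hs : ((Equiv.Perm.sign e : ℤ) : L) ≠ 0 := by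
    rcases Int.units_eq_one_or (Equiv.Perm.sign e) with h | h <;> simp [h]
  exact mul_left_cancel₀ hs (mul_left_cancel₀ hγ' hdet)

/-- Wedderburn's criterion: if none of `γ, …, γ ^ (n - 1)` is a norm, then every nonzero element
of the cyclic algebra is invertible. -/
theorem det_layerMatrix_ne_zero [FiniteDimensional K L] [IsGalois K L] {k : ℕ}
    (hn : Module.finrank K L = k + 1) (σ : L ≃ₐ[K] L)
    (hσ : ∀ τ : L ≃ₐ[K] L, τ ∈ Subgroup.zpowers σ) (γ : K)
    (hγ : ∀ j : ℕ, 0 < j → j < k + 1 → ∀ y : L, Algebra.norm K y ≠ γ ^ j)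
    {x : Fin (k + 1) → L} (hx : x ≠ 0) : (layerMatrix σ γ x).det ≠ 0 := by
  have hσn := pow_finrank_eq_one hn σ
  intro hdet
  -- `W` is the left annihilator of `x`, an `L`-subspace stable under left multiplication by `e`.
  -- The `n`-th iterate of that map is `γ`, so `γ ^ dim W` is a norm; it remains to see `0 < dim W <
  -- n`.
  let W : Submodule L (Fin (k + 1) → L) := LinearMap.ker (layerMatrix σ γ x).vecMulLinear
  have hW : ∀ v, v ∈ W ↔ Matrix.vecMul v (layerMatrix σ γ x) = 0 := fun v => by simp [W]
  have hstable : ∀ v ∈ W, shift σ γ v ∈ W := by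
    intro v hv
    rw [hW] at hv ⊢
    rw [← shift_vecMul σ hσn, hv, map_zero]
  let φ : W →+ W :=
    { toFun := fun v => ⟨shift σ γ v, hstable v v.2⟩
      map_zero' := by ext; simp
      map_add' := fun v w => by ext; simp }
  have hiter : ∀ (r : ℕ) (v : W), ((φ^[r] v : W) : Fin (k + 1) → L) = (shift σ γ)^[r] v := by
    intro r
    induction r with
    | zero => simp
    | succ r ih =>
      intro v
      rw [Function.iterate_succ_apply', Function.iterate_succ_apply', ← ih]
      rfl
  obtain ⟨y, hy⟩ := exists_norm_eq_pow_finrank hn σ hσ γ φ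
    (fun c v => Subtype.ext (shift_smul σ γ c (v : Fin (k + 1) → L)))
    (fun v => Subtype.ext (by rw [hiter, iterate_shift_eq_smul σ hσn]; rfl))
  refine hγ _ ?_ ?_ y hy
  · obtain ⟨v, hv0, hv⟩ := Matrix.exists_vecMul_eq_zero_iff.2 hdet
    have : Nontrivial W := ⟨⟨v, (hW v).2 hv⟩, 0, fun h => hv0 (congrArg Subtype.val h)⟩
    exact Module.finrank_pos
  · have hlt : W < ⊤ := by
      refine lt_of_le_of_ne le_top fun htop => hx ?_
      -- This vector is the unit `1` of the algebra, and `1 · x = x`.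
      have h1 : (Pi.single 0 1 : Fin (k + 1) → L) ∈ W := htop ▸ Submodule.mem_top
      rw [hW, Matrix.single_one_vecMul] at h1
      ext l
      have := congrFun h1 l
      simpa [layerMatrix] using this
    simpa using Submodule.finrank_lt_finrank_of_lt hlt

end LayerMatrix

end LSTIC

namespace LSTIC

/-! ### Class number one and positivity of norms over `ℚ(i)` and `ℚ(ω)`. -/

section ImaginaryQuadratic

open NumberField

/-- Minkowski's bound is enough: for degree two with one complex place it asks for `|discr| < π²`,
and here `|discr| = 4`. -/
theorem isPrincipalIdealRing_of_isCyclotomicExtension_four (K : Type*) [Field K] [NumberField K]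
    [IsCyclotomicExtension {4} ℚ K] : IsPrincipalIdealRing (𝓞 K) := by
  apply RingOfIntegers.isPrincipalIdealRing_of_abs_discr_lt
  have h4 : Nat.totient 4 = 2 := by decide
  have : IsCyclotomicExtension {2 ^ (1 + 1)} ℚ K := by
    norm_num; infer_instance
  have : Fact (Nat.Prime 2) := ⟨Nat.prime_two⟩
  have hd : discr K = -4 := by
    have := IsCyclotomicExtension.Rat.discr_prime_pow 2 (1 + 1) K
    norm_num at this
    simpa [h4, Nat.totient_prime_pow] using this
  rw [hd, IsCyclotomicExtension.finrank (n := 4) K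
    (Polynomial.cyclotomic.irreducible_rat (by simp)),
    IsCyclotomicExtension.Rat.nrComplexPlaces_eq_totient_div_two 4, h4]
  have := Real.pi_gt_three
  norm_num [Nat.factorial]
  nlinarith

variable {K : Type*} [Field K] [NumberField K]

theorem isPrincipalIdealRing_of_cyclotomic
    (hK : IsCyclotomicExtension {4} ℚ K ∨ IsCyclotomicExtension {3} ℚ K) :
    IsPrincipalIdealRing (𝓞 K) := by
  rcases hK with hK | hK
  · exact isPrincipalIdealRing_of_isCyclotomicExtension_four K
  · exact IsCyclotomicExtension.Rat.three_pid K

theorem finrank_eq_two_of_cyclotomic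
    (hK : IsCyclotomicExtension {4} ℚ K ∨ IsCyclotomicExtension {3} ℚ K) :
    Module.finrank ℚ K = 2 := by
  rcases hK with hK | hK
  · rw [IsCyclotomicExtension.finrank (n := 4) K
      (Polynomial.cyclotomic.irreducible_rat (by simp))]
    decide
  · rw [IsCyclotomicExtension.finrank (n := 3) K
      (Polynomial.cyclotomic.irreducible_rat (by simp))]
    decide

theorem isTotallyComplex_of_cyclotomic
    (hK : IsCyclotomicExtension {4} ℚ K ∨ IsCyclotomicExtension {3} ℚ K) :
    IsTotallyComplex K := by
  rcases hK with hK | hK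
  · exact IsCyclotomicExtension.Rat.isTotallyComplex K (n := 4) (by norm_num)
  · exact IsCyclotomicExtension.Rat.isTotallyComplex K (n := 3) (by norm_num)

/-- In an imaginary quadratic field the norm is the square of the absolute value. -/
theorem norm_eq_sq_norm_embedding [IsTotallyComplex K] (h2 : Module.finrank ℚ K = 2)
    (φ : K →+* ℂ) (a : K) : ((Algebra.norm ℚ a : ℚ) : ℝ) = ‖φ a‖ ^ 2 := by
  classical
  have hne : φ.toRatAlgHom ≠ (ComplexEmbedding.conjugate φ).toRatAlgHom := by
    intro h
    refine IsTotallyComplex.complexEmbedding_not_isReal φ ?_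
    ext x
    exact (DFunLike.congr_fun h x).symm
  have huniv : (Finset.univ : Finset (K →ₐ[ℚ] ℂ)) =
      {φ.toRatAlgHom, (ComplexEmbedding.conjugate φ).toRatAlgHom} := by
    symm
    refine Finset.eq_univ_of_card _ ?_
    rw [Finset.card_pair hne, AlgHom.card, h2]
  have h := Algebra.norm_eq_prod_embeddings ℚ ℂ a
  rw [huniv, Finset.prod_pair hne] at h
  have h' : ((Algebra.norm ℚ a : ℚ) : ℂ) = φ a * starRingEnd ℂ (φ a) := h
  rw [Complex.mul_conj'] at h'
  exact_mod_cast h'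

theorem abs_norm_eq_absNorm_span {F : Type*} [Field F] [NumberField F] (x : 𝓞 F) :
    |Algebra.norm ℚ (x : F)| = (Ideal.absNorm (Ideal.span {x}) : ℚ) := by
  rw [Ideal.absNorm_span_singleton, ← Algebra.coe_norm_int, Nat.cast_natAbs, Int.cast_abs]

theorem sq_norm_embedding_eq_absNorm [IsTotallyComplex K] (h2 : Module.finrank ℚ K = 2)
    (φ : K →+* ℂ) (a : 𝓞 K) : ‖φ a‖ ^ 2 = (Ideal.absNorm (Ideal.span {a}) : ℝ) := by
  have h := norm_eq_sq_norm_embedding h2 φ (a : K)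
  have h' : (|Algebra.norm ℚ (a : K)| : ℚ) = ‖φ a‖ ^ 2 := by
    rw [Rat.cast_abs, h, abs_of_nonneg (by positivity)]
  rw [← h', abs_norm_eq_absNorm_span, Rat.cast_natCast]

variable {L : Type*} [Field L] [NumberField L] [Algebra K L]

theorem absNorm_span_algebraMap (a : 𝓞 K) :
    Ideal.absNorm (Ideal.span {algebraMap (𝓞 K) (𝓞 L) a}) =
      Ideal.absNorm (Ideal.span {a}) ^ Module.finrank K L := by
  have h : ((Ideal.absNorm (Ideal.span {algebraMap (𝓞 K) (𝓞 L) a}) : ℕ) : ℚ) =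
      (Ideal.absNorm (Ideal.span {a}) : ℚ) ^ Module.finrank K L := by
    rw [← abs_norm_eq_absNorm_span, ← abs_norm_eq_absNorm_span, ← abs_pow, ← map_pow,
      ← Algebra.norm_algebraMap, Algebra.norm_norm]
    rfl
  exact_mod_cast h

/-- `N_{L/ℚ}` factors through `N_{K/ℚ}`, which is a squared absolute value, so the norm is
nonnegative. -/
theorem norm_eq_absNorm_span [IsTotallyComplex K] (h2 : Module.finrank ℚ K = 2) (φ : K →+* ℂ)
    (x : 𝓞 L) :
    ((Algebra.norm ℚ (x : L) : ℚ) : ℝ) = (Ideal.absNorm (Ideal.span {x}) : ℝ) := by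
  rw [← Rat.cast_natCast, ← abs_norm_eq_absNorm_span, Rat.cast_abs, abs_of_nonneg]
  rw [← Algebra.norm_norm (S := K), norm_eq_sq_norm_embedding h2 φ]
  positivity

/-- Excludes `n = 1`, where the condition on `γ` is empty and `γ = 0` is possible. -/
theorem isPrincipal_of_finrank_eq_one [IsPrincipalIdealRing (𝓞 K)]
    (h1 : Module.finrank K L = 1) (I : Ideal (𝓞 L)) : Submodule.IsPrincipal I := by
  have hb : Function.Bijective (algebraMap K L) :=
    Algebra.finrank_eq_one_iff_bijective_algebraMap.1 h1
  let e : 𝓞 K ≃+* 𝓞 L := RingOfIntegers.mapRingEquiv (RingEquiv.ofBijective _ hb)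
  have := IsPrincipalIdealRing.of_surjective e.toRingHom e.surjective
  exact IsPrincipalIdealRing.principal I

end ImaginaryQuadratic

/-! ### Norms of conjugate and of non-principal ideals. -/

section IdealNorms

variable {L : Type*} [Field L] [NumberField L]

theorem absNorm_map_ringEquiv (e : 𝓞 L ≃+* 𝓞 L) (J : Ideal (𝓞 L)) :
    Ideal.absNorm (J.map (e : 𝓞 L →+* 𝓞 L)) = Ideal.absNorm J := by
  rw [Ideal.absNorm_apply, Ideal.absNorm_apply, Submodule.cardQuot_apply,
    Submodule.cardQuot_apply]
  exact (Nat.card_congr (Ideal.quotientEquiv J _ e rfl).toEquiv).symm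

/-- Write `(x) = I J`. Here `J ≠ (1)`, as otherwise `I = (x)`, so `N(J) ≥ 2`. -/
theorem absNorm_lt_of_not_isPrincipal {I : Ideal (𝓞 L)} (hI : ¬ Submodule.IsPrincipal I)
    {x : 𝓞 L} (hx : x ∈ I) (hx0 : x ≠ 0) :
    Ideal.absNorm I < Ideal.absNorm (Ideal.span {x}) := by
  obtain ⟨J, hJ⟩ := Ideal.dvd_span_singleton.2 hx
  have hne : Ideal.absNorm (Ideal.span {x}) ≠ 0 := by
    rw [Ne, Ideal.absNorm_eq_zero_iff]; simpa using hx0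
  rw [hJ, map_mul] at hne ⊢
  have hI0 : 0 < Ideal.absNorm I := Nat.pos_of_ne_zero (left_ne_zero_of_mul hne)
  have hJ0 : Ideal.absNorm J ≠ 0 := right_ne_zero_of_mul hne
  have hJ1 : Ideal.absNorm J ≠ 1 := by
    rw [Ne, Ideal.absNorm_eq_one_iff]
    rintro rfl
    rw [Ideal.mul_top] at hJ
    exact hI ⟨x, hJ.symm⟩
  exact lt_mul_of_one_lt_right hI0 (by omega)

end IdealNorms

/-! ### Integrality and divisibility of the reduced norm. -/

section ReducedNorm

open NumberField

variable {K L : Type*} [Field K] [Field L] [Algebra K L]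

/-- `layerMatrix` over the ring of integers. -/
def integralMatrix {n : ℕ} (σ : L ≃ₐ[K] L) (γ : 𝓞 K) (x : Fin n → 𝓞 L) :
    Matrix (Fin n) (Fin n) (𝓞 L) :=
  Matrix.of fun m j => (if j < m then algebraMap (𝓞 K) (𝓞 L) γ else 1) *
    RingOfIntegers.mapRingEquiv (σ ^ (m : ℕ)).toRingEquiv (x (j - m))

theorem integralMatrix_map {n : ℕ} (σ : L ≃ₐ[K] L) (γ : 𝓞 K) (x : Fin n → 𝓞 L) :
    (integralMatrix σ γ x).map (algebraMap (𝓞 L) L) =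
      layerMatrix σ (γ : K) fun l => (x l : L) := by
  ext m j
  simp only [integralMatrix, layerMatrix, Matrix.map_apply, Matrix.of_apply, map_mul]
  congr 1
  split_ifs
  · rfl
  · exact map_one _

/-- Each term of the Leibniz expansion takes one entry from every row, and row `m` lies in `σ^m(J)`.
The transpose makes the expansion run over rows. -/
theorem det_integralMatrix_mem {n : ℕ} (σ : L ≃ₐ[K] L) (γ : 𝓞 K) {x : Fin n → 𝓞 L}
    {J : Ideal (𝓞 L)} (hx : ∀ l, x l ∈ J) :
    (integralMatrix σ γ x).det ∈ ∏ m : Fin n,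
      J.map (RingOfIntegers.mapRingEquiv (σ ^ (m : ℕ)).toRingEquiv : 𝓞 L →+* 𝓞 L) := by
  rw [← Matrix.det_transpose, Matrix.det_apply]
  refine Submodule.sum_mem _ fun p _ => ?_
  rw [Units.smul_def]
  refine zsmul_mem (Ideal.prod_mem_prod fun m _ => ?_) _
  exact Ideal.mul_mem_left _ _ (Ideal.mem_map_of_mem _ (hx _))

/-- The reduced norm of a nonzero element of the cyclic division algebra with layers in `J` is a
nonzero integer of `K`, whose norm is divisible by the norm of `J`. -/
theorem exists_det_eq_algebraMap [NumberField K] [NumberField L] [IsGalois K L] {n : ℕ} (hn0 : 1 < n)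
    (hn : Module.finrank K L = n)
    (σ : L ≃ₐ[K] L) (hσ : ∀ τ : L ≃ₐ[K] L, τ ∈ Subgroup.zpowers σ)
    (γ : 𝓞 K) (hγ : ∀ j : ℕ, 0 < j → j < n → ∀ y : L, Algebra.norm K y ≠ (γ : K) ^ j)
    (x : Fin n → 𝓞 L) :
    ∃ d : 𝓞 K, algebraMap K L d = (layerMatrix σ (γ : K) fun l => (x l : L)).det ∧
      (x ≠ 0 → d ≠ 0) ∧
      ∀ J : Ideal (𝓞 L), (∀ l, x l ∈ J) → Ideal.absNorm J ∣ Ideal.absNorm (Ideal.span {d}) := by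
  obtain ⟨k, rfl⟩ : ∃ k, n = k + 1 := ⟨n - 1, by omega⟩
  have hγ0 : (γ : K) ≠ 0 := by
    intro h
    -- Zero is the norm of zero, so the hypothesis at exponent `1 < n` rules out `γ = 0`.
    refine hγ 1 one_pos hn0 0 ?_
    rw [h, pow_one, Algebra.norm_zero]
  have hσn := pow_finrank_eq_one hn σ
  have hfix : ∀ τ : L ≃ₐ[K] L, τ (layerMatrix σ (γ : K) fun l => (x l : L)).det =
      (layerMatrix σ (γ : K) fun l => (x l : L)).det := by
    intro τ
    have : σ ∈ MulAction.stabilizer (L ≃ₐ[K] L)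
        (layerMatrix σ (γ : K) fun l => (x l : L)).det := map_det_layerMatrix σ hσn hγ0 _
    exact (Subgroup.zpowers_le.2 this) (hσ τ)
  have hdet : ((integralMatrix σ γ x).det : L) =
      (layerMatrix σ (γ : K) fun l => (x l : L)).det := by
    rw [← integralMatrix_map, ← RingHom.mapMatrix_apply, ← RingHom.map_det]
  obtain ⟨d, hd⟩ := (IsGalois.mem_range_algebraMap_iff_fixed _).2 hfix
  obtain ⟨D, rfl⟩ : ∃ D : 𝓞 K, (D : K) = d := by
    refine ⟨⟨d, ?_⟩, rfl⟩
    change IsIntegral ℤ d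
    rw [← isIntegral_algebraMap_iff (algebraMap K L).injective, hd, ← hdet]
    exact RingOfIntegers.isIntegral_coe _
  refine ⟨D, hd, fun hx hd0 => ?_, fun J hJ => ?_⟩
  · refine det_layerMatrix_ne_zero hn σ hσ (γ : K) hγ (x := fun l => (x l : L)) ?_ ?_
    · intro h
      exact hx (funext fun l => RingOfIntegers.ext (congrFun h l))
    · rw [← hd, hd0]; simp
  · have heq : algebraMap (𝓞 K) (𝓞 L) D = (integralMatrix σ γ x).det :=
      RingOfIntegers.ext (by rw [hdet, ← hd]; rfl)
    -- Conjugate ideals have equal norms, and extending `(d)` to `L` raises its norm to the power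
    -- `n`. Hence `N(J)^n ∣ N(d)^n`, and the exponent cancels.
    have h := Ideal.absNorm_dvd_absNorm_of_le
      ((Ideal.span_singleton_le_iff_mem _).2 (det_integralMatrix_mem σ γ hJ))
    rw [← heq, absNorm_span_algebraMap, map_prod, hn] at h
    simp only [absNorm_map_ringEquiv, Finset.prod_const, Finset.card_univ, Fintype.card_fin] at h
    exact (Nat.pow_dvd_pow_iff (Nat.succ_ne_zero k)).1 h

end ReducedNorm

end LSTIC

namespace LSTIC

open NumberField

/-! ### Additivity and determinants of codewords. -/

section Codewords

variable {K L : Type*} [Field K] [Field L] [Algebra K L] {n : ℕ}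

theorem codeword_eq_map (ι : L →+* ℂ) (σ : L ≃ₐ[K] L) (γ : 𝓞 K) (x : Fin n → 𝓞 L) :
    codeword ι σ γ x = (layerMatrix σ (γ : K) fun l => (x l : L)).map ι := rfl

theorem codeword_add (ι : L →+* ℂ) (σ : L ≃ₐ[K] L) (γ : 𝓞 K) (x y : Fin n → 𝓞 L) :
    codeword ι σ γ (x + y) = codeword ι σ γ x + codeword ι σ γ y := by
  ext m j
  simp only [codeword, Matrix.of_apply, Matrix.add_apply, Pi.add_apply, map_add, map_mul, mul_add]

theorem codeword_zero (ι : L →+* ℂ) (σ : L ≃ₐ[K] L) (γ : 𝓞 K) :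
    codeword ι σ γ (0 : Fin n → 𝓞 L) = 0 := by
  have := codeword_add ι σ γ (0 : Fin n → 𝓞 L) 0
  simpa using this

theorem codeword_sub (ι : L →+* ℂ) (σ : L ≃ₐ[K] L) (γ : 𝓞 K) (x y : Fin n → 𝓞 L) :
    codeword ι σ γ (x - y) = codeword ι σ γ x - codeword ι σ γ y := by
  rw [eq_sub_iff_add_eq, ← codeword_add, sub_add_cancel]

theorem det_codeword_mul_conjTranspose (ι : L →+* ℂ) (σ : L ≃ₐ[K] L) (γ : 𝓞 K)
    (x : Fin n → 𝓞 L) :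
    (codeword ι σ γ x * (codeword ι σ γ x).conjTranspose).det =
      ((‖ι (layerMatrix σ (γ : K) fun l => (x l : L)).det‖ ^ 2 : ℝ) : ℂ) := by
  have h : (codeword ι σ γ x).det = ι (layerMatrix σ (γ : K) fun l => (x l : L)).det := by
    rw [codeword_eq_map, ← RingHom.mapMatrix_apply, ← RingHom.map_det]
  rw [Matrix.det_mul, Matrix.det_conjTranspose, h, RCLike.star_def, Complex.mul_conj']
  push_cast
  rfl

/-- With only layer `0` present the matrix is diagonal, with the conjugates of `a` on the diagonal.
-/
theorem det_layerMatrix_single [FiniteDimensional K L] [IsGalois K L] {k : ℕ}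
    (hn : Module.finrank K L = k + 1) (σ : L ≃ₐ[K] L)
    (hσ : ∀ τ : L ≃ₐ[K] L, τ ∈ Subgroup.zpowers σ) (γ : K) (a : L) :
    (layerMatrix σ γ (Pi.single (0 : Fin (k + 1)) a)).det =
      algebraMap K L (Algebra.norm K a) := by
  have : layerMatrix σ γ (Pi.single (0 : Fin (k + 1)) a) =
      Matrix.diagonal fun m : Fin (k + 1) => (σ ^ (m : ℕ)) a := by
    ext m j
    rcases eq_or_ne j m with rfl | h
    · simp [layerMatrix]
    · have h' : j - m ≠ 0 := sub_ne_zero.2 h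
      rw [Matrix.diagonal_apply_ne' _ h, layerMatrix, Matrix.of_apply, Pi.single_eq_of_ne h',
        map_zero, mul_zero]
  rw [this, Matrix.det_diagonal, algebraMap_norm_eq_prod_range hn σ hσ,
    Fin.prod_univ_eq_prod_range (fun i => (σ ^ i) a)]

end Codewords

/-! ### Gram determinants as norms. -/

section Determinants

variable {K L : Type*} [Field K] [NumberField K] [Field L] [NumberField L] [Algebra K L]

/-- The determinant of a codeword Gram matrix is a natural number, positive for `x ≠ 0`, and
divisible by the norm of every ideal which contains all layers. -/
theorem exists_det_codeword_eq_natCast [IsTotallyComplex K] (h2 : Module.finrank ℚ K = 2)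
    [IsGalois K L] {n : ℕ} (hn0 : 1 < n) (hn : Module.finrank K L = n)
    (σ : L ≃ₐ[K] L) (hσ : ∀ τ : L ≃ₐ[K] L, τ ∈ Subgroup.zpowers σ)
    (γ : 𝓞 K) (hγ : ∀ j : ℕ, 0 < j → j < n → ∀ y : L, Algebra.norm K y ≠ (γ : K) ^ j)
    (ι : L →+* ℂ) (x : Fin n → 𝓞 L) :
    ∃ D : ℕ, (codeword ι σ γ x * (codeword ι σ γ x).conjTranspose).det = (D : ℂ) ∧
      (x ≠ 0 → 0 < D) ∧
      ∀ J : Ideal (𝓞 L), (∀ l, x l ∈ J) → Ideal.absNorm J ∣ D := by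
  obtain ⟨d, hd, hd0, hJ⟩ := exists_det_eq_algebraMap hn0 hn σ hσ γ hγ x
  refine ⟨Ideal.absNorm (Ideal.span {d}), ?_, fun hx => Nat.pos_of_ne_zero ?_, hJ⟩
  · have h := sq_norm_embedding_eq_absNorm h2 (ι.comp (algebraMap K L)) d
    rw [det_codeword_mul_conjTranspose, ← hd]
    rw [RingHom.comp_apply] at h
    rw [h, Complex.ofReal_natCast]
  · rw [Ne, Ideal.absNorm_eq_zero_iff]
    simpa using hd0 hx

theorem det_codeword_single [IsTotallyComplex K] (h2 : Module.finrank ℚ K = 2)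
    [IsGalois K L] {k : ℕ} (hn : Module.finrank K L = k + 1)
    (σ : L ≃ₐ[K] L) (hσ : ∀ τ : L ≃ₐ[K] L, τ ∈ Subgroup.zpowers σ)
    (γ : 𝓞 K) (ι : L →+* ℂ) (a : 𝓞 L) :
    (codeword ι σ γ (Pi.single (0 : Fin (k + 1)) a) *
      (codeword ι σ γ (Pi.single (0 : Fin (k + 1)) a)).conjTranspose).det =
        (((Algebra.norm ℚ (a : L) : ℚ) : ℝ) : ℂ) := by
  have hs : (fun l => ((Pi.single (0 : Fin (k + 1)) a : Fin (k + 1) → 𝓞 L) l : L)) =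
      Pi.single (0 : Fin (k + 1)) (a : L) := by
    ext l
    rcases eq_or_ne l 0 with rfl | h
    · simp
    · simp [h]
  rw [det_codeword_mul_conjTranspose, hs, det_layerMatrix_single hn σ hσ,
    ← Algebra.norm_norm (R := ℚ) (S := K),
    norm_eq_sq_norm_embedding h2 (ι.comp (algebraMap K L)), RingHom.comp_apply]

end Determinants

/-! ### Recovering the messages from the layers. -/

section Residues

variable {L : Type*} [Field L] {κ : ℕ}

theorem residues_leader (I : Ideal (𝓞 L)) (q : Fin κ → Ideal (𝓞 L))
    (hq : Pairwise fun i j => IsCoprime (q i) (q j)) (hI : ∀ k, IsCoprime I (q k))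
    {leader : I ⧸ shaping I q → I} (hleader : ∀ c, (shaping I q).mkQ (leader c) = c)
    (c : I ⧸ shaping I q) : residues I q (leader c) = layerEquiv I q hq hI c := by
  conv_rhs => rw [← hleader c]
  rfl

theorem mk_layers {n : ℕ} (I : Ideal (𝓞 L)) (q : Fin κ → Ideal (𝓞 L))
    (hq : Pairwise fun i j => IsCoprime (q i) (q j)) (hI : ∀ k, IsCoprime I (q k))
    {leader : I ⧸ shaping I q → I} (hleader : ∀ c, (shaping I q).mkQ (leader c) = c)
    (w : (k : Fin κ) → Fin n → 𝓞 L ⧸ q k) (k : Fin κ) (l : Fin n) :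
    Ideal.Quotient.mk (q k) (layers I q hq hI leader w l) = w k l := by
  have h := residues_leader I q hq hI hleader ((layerEquiv I q hq hI).symm fun k => w k l)
  rw [LinearEquiv.apply_symm_apply] at h
  exact congrFun h k

/-- Pairwise coprimality turns the product of ideals into an intersection. -/
theorem mem_mul_prod {I : Ideal (𝓞 L)} {q : Fin κ → Ideal (𝓞 L)}
    (hq : Pairwise fun i j => IsCoprime (q i) (q j)) (hI : ∀ k, IsCoprime I (q k))
    (S : Finset (Fin κ)) {x : 𝓞 L} (hx : x ∈ I) (hS : ∀ s ∈ S, x ∈ q s) :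
    x ∈ I * ∏ s ∈ S, q s := by
  rw [Ideal.mul_eq_inf_of_isCoprime (IsCoprime.prod_right fun k _ => hI k),
    Ideal.prod_eq_iInf_of_pairwise_isCoprime fun i _ j _ h => hq h]
  simpa [hx] using hS

theorem mul_prod_univ_le (I : Ideal (𝓞 L)) (q : Fin κ → Ideal (𝓞 L)) (S : Finset (Fin κ)) :
    I * ∏ k, q k ≤ I * ∏ s ∈ S, q s := by
  refine Ideal.mul_mono_right ?_
  rw [← Finset.prod_sdiff (Finset.subset_univ S)]
  exact Ideal.mul_le_right

theorem layers_mem {n : ℕ} (I : Ideal (𝓞 L)) (q : Fin κ → Ideal (𝓞 L))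
    (hq : Pairwise fun i j => IsCoprime (q i) (q j)) (hI : ∀ k, IsCoprime I (q k))
    (leader : I ⧸ shaping I q → I) (w : (k : Fin κ) → Fin n → 𝓞 L ⧸ q k) (l : Fin n) :
    layers I q hq hI leader w l ∈ I := Subtype.property _

end Residues

/-! ### Differences in the translated lattices. -/

section Periodic

variable {K L : Type*} [Field K] [Field L] [Algebra K L] {n κ : ℕ}

/-- Layers of messages that agree on `S` are congruent modulo each `𝔮_s`, and they lie in `I`. The
periodic part contributes only elements of `I𝔮 ⊆ I ∏_{s ∈ S} 𝔮_s`. -/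
theorem exists_sub_eq_codeword (ι : L →+* ℂ) (σ : L ≃ₐ[K] L) (γ : 𝓞 K) (I : Ideal (𝓞 L))
    (q : Fin κ → Ideal (𝓞 L)) (hq : Pairwise fun i j => IsCoprime (q i) (q j))
    (hI : ∀ k, IsCoprime I (q k)) {leader : I ⧸ shaping I q → I}
    (hleader : ∀ c, (shaping I q).mkQ (leader c) = c) (S : Finset (Fin κ))
    (v : (k : Fin κ) → Fin n → 𝓞 L ⧸ q k) {X X' : Matrix (Fin n) (Fin n) ℂ}
    (hX : X ∈ periodic ι σ γ I q (subcode ι σ γ I q hq hI leader S v))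
    (hX' : X' ∈ periodic ι σ γ I q (subcode ι σ γ I q hq hI leader S v)) :
    ∃ z : Fin n → 𝓞 L, (∀ l, z l ∈ I * ∏ s ∈ S, q s) ∧ X - X' = codeword ι σ γ z := by
  obtain ⟨_, ⟨w, hw, rfl⟩, _, ⟨y, hy, rfl⟩, rfl⟩ := hX
  obtain ⟨_, ⟨w', hw', rfl⟩, _, ⟨y', hy', rfl⟩, rfl⟩ := hX'
  refine ⟨(layers I q hq hI leader w + y) - (layers I q hq hI leader w' + y'), fun l => ?_, ?_⟩
  · have h1 : layers I q hq hI leader w l - layers I q hq hI leader w' l ∈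
        I * ∏ s ∈ S, q s := by
      refine mem_mul_prod hq hI S
        (sub_mem (layers_mem I q hq hI leader w l) (layers_mem I q hq hI leader w' l))
        fun s hs => ?_
      rw [← Ideal.Quotient.eq, mk_layers I q hq hI hleader, mk_layers I q hq hI hleader,
        hw s hs, hw' s hs]
    have h2 := mul_prod_univ_le I q S (sub_mem (hy l) (hy' l))
    have := add_mem h1 h2
    simpa only [Pi.sub_apply, Pi.add_apply, add_sub_add_comm] using this
  · rw [codeword_sub, codeword_add, codeword_add]

/-- Take the residues of `x` as messages: their layers differ from `x` by elements of `I𝔮`. So every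
codeword of `C_I` is available as a witness for an upper bound on `δ(C)`. -/
theorem codeword_mem_periodic_codebook (ι : L →+* ℂ) (σ : L ≃ₐ[K] L) (γ : 𝓞 K)
    (I : Ideal (𝓞 L)) (q : Fin κ → Ideal (𝓞 L))
    (hq : Pairwise fun i j => IsCoprime (q i) (q j))
    (hI : ∀ k, IsCoprime I (q k)) {leader : I ⧸ shaping I q → I}
    (hleader : ∀ c, (shaping I q).mkQ (leader c) = c) {x : Fin n → 𝓞 L} (hx : ∀ l, x l ∈ I) :
    codeword ι σ γ x ∈ periodic ι σ γ I q (codebook n ι σ γ I q hq hI leader) := by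
  let w : (k : Fin κ) → Fin n → 𝓞 L ⧸ q k := fun k l => Ideal.Quotient.mk (q k) (x l)
  refine ⟨_, ⟨w, rfl⟩, _, ⟨x - layers I q hq hI leader w, fun l => ?_, rfl⟩, ?_⟩
  · refine mem_mul_prod hq hI Finset.univ
      (sub_mem (hx l) (layers_mem I q hq hI leader w l)) fun s _ => ?_
    rw [Pi.sub_apply, ← Ideal.Quotient.eq, mk_layers I q hq hI hleader]
  · rw [← codeword_add, add_sub_cancel]

/-- The full code is the case of no side information, so results on subcodes cover it. -/
theorem codebook_eq_subcode (ι : L →+* ℂ) (σ : L ≃ₐ[K] L) (γ : 𝓞 K) (I : Ideal (𝓞 L))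
    (q : Fin κ → Ideal (𝓞 L)) (hq : Pairwise fun i j => IsCoprime (q i) (q j))
    (hI : ∀ k, IsCoprime I (q k)) (leader : I ⧸ shaping I q → I) :
    codebook n ι σ γ I q hq hI leader = subcode ι σ γ I q hq hI leader ∅ fun _ _ => 0 := by
  simp [codebook, subcode]

end Periodic

/-! ### Existence of minima, rates, and the numerical estimate. -/

section Bounds

theorem isLeast_sInf_of_subset_range_natCast {s : Set ℝ} (hne : s.Nonempty)
    (hs : s ⊆ Set.range ((↑) : ℕ → ℝ)) : IsLeast s (sInf s) := by
  classical
  have hex : ∃ m : ℕ, (m : ℝ) ∈ s := by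
    obtain ⟨d, hd⟩ := hne
    obtain ⟨m, rfl⟩ := hs hd
    exact ⟨m, hd⟩
  have hleast : IsLeast s (Nat.find hex : ℝ) := by
    refine ⟨Nat.find_spec hex, fun d hd => ?_⟩
    obtain ⟨m, rfl⟩ := hs hd
    exact_mod_cast Nat.find_min' hex hd
  rwa [hleast.csInf_eq]

variable {L : Type*} [Field L] [NumberField L]

theorem messageRate_eq {n : ℕ} (hn : n ≠ 0) (J : Ideal (𝓞 L)) :
    messageRate n J = Real.logb 2 (Ideal.absNorm J) / (2 * n) := by
  have h : Nat.card (Fin n → 𝓞 L ⧸ J) = Ideal.absNorm J ^ n := by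
    rw [Nat.card_fun, Nat.card_fin, Ideal.absNorm_apply, Submodule.cardQuot_apply]
  have hn' : (n : ℝ) ≠ 0 := by exact_mod_cast hn
  rw [messageRate, h, Nat.cast_pow, Real.logb_pow]
  field_simp

/-- Rates add because ideal norms multiply. Nonzero ideals are required for the logarithm of the
product to split. -/
theorem sideInfoRate_eq {n κ : ℕ} (hn : n ≠ 0) {q : Fin κ → Ideal (𝓞 L)} (hq : ∀ k, q k ≠ ⊥)
    (S : Finset (Fin κ)) :
    sideInfoRate n q S = Real.logb 2 (Ideal.absNorm (∏ s ∈ S, q s)) / (2 * n) := by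
  rw [sideInfoRate, Finset.sum_congr rfl fun s _ => messageRate_eq hn (q s), ← Finset.sum_div,
    map_prod, Nat.cast_prod, Real.logb_prod]
  intro s _
  have : Ideal.absNorm (q s) ≠ 0 := by simpa [Ideal.absNorm_eq_zero_iff] using hq s
  exact_mod_cast this

/-- Used with `N = N(I)`, `M` the least norm on `I`, and `Q` the norm of the side-information ideal.
From `δ'/δ ≥ Q N/M` and `log₁₀ Q = log₁₀ 2 · log₂ Q`, the main term is `20 log₁₀ 2`. The remaining
term is nonpositive and is divided by `log₂ Q ≥ 1`. -/
theorem gain_lower_bound {N M δ δ' Q : ℝ} (hN : 0 < N) (hNM : N ≤ M) (hδ : 0 < δ) (hδM : δ ≤ M)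
    (hQ : 2 ≤ Q) (hδ' : N * Q ≤ δ') :
    20 * Real.logb 10 2 + 20 * Real.logb 10 (N / M) ≤
      10 * Real.logb 10 (δ' / δ) / (Real.logb 2 Q / 2) := by
  have hM : 0 < M := hN.trans_le hNM
  have hQ0 : 0 < Q := by linarith
  have hlogQ : 1 ≤ Real.logb 2 Q := by
    rw [Real.le_logb_iff_rpow_le (by norm_num) hQ0]; simpa using hQ
  have hneg : Real.logb 10 (N / M) ≤ 0 :=
    Real.logb_nonpos (by norm_num) (by positivity) ((div_le_one hM).2 hNM)
  have hchange : Real.logb 10 2 * Real.logb 2 Q = Real.logb 10 Q :=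
    Real.mul_logb (by norm_num) (by norm_num) (by norm_num)
  have hratio : Q * (N / M) ≤ δ' / δ := by
    rw [mul_div_assoc', div_le_div_iff₀ hM hδ]
    nlinarith [mul_pos hN hQ0]
  have hlog : Real.logb 10 Q + Real.logb 10 (N / M) ≤ Real.logb 10 (δ' / δ) := by
    rw [← Real.logb_mul hQ0.ne' (by positivity)]
    exact Real.logb_le_logb_of_le (by norm_num) (by positivity) hratio
  rw [le_div_iff₀ (by linarith)]
  nlinarith [mul_nonneg (sub_nonneg.2 hlogQ) (neg_nonneg.2 hneg)]

theorem six_le_logb : (6 : ℝ) ≤ 20 * Real.logb 10 2 := by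
  have h : Real.logb 10 ((10 : ℝ) ^ 6) ≤ Real.logb 10 ((2 : ℝ) ^ 20) :=
    Real.logb_le_logb_of_le (by norm_num) (by norm_num) (by norm_num)
  rw [Real.logb_pow, Real.logb_pow, Real.logb_self_eq_one (by norm_num)] at h
  norm_num at h
  linarith

end Bounds

/-! ### Lower and upper bounds for the minimum determinants. -/

section MinimumDeterminant

variable {K L : Type*} [Field K] [NumberField K] [Field L] [NumberField L] [Algebra K L]

theorem detValues_subcode_nonempty [IsTotallyComplex K] (h2 : Module.finrank ℚ K = 2)
    [IsGalois K L] {n κ : ℕ} (hn0 : 1 < n) (hn : Module.finrank K L = n)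
    (σ : L ≃ₐ[K] L) (hσ : ∀ τ : L ≃ₐ[K] L, τ ∈ Subgroup.zpowers σ)
    (γ : 𝓞 K) (hγ : ∀ j : ℕ, 0 < j → j < n → ∀ y : L, Algebra.norm K y ≠ (γ : K) ^ j)
    (ι : L →+* ℂ) {I : Ideal (𝓞 L)} (hI0 : I ≠ ⊥) {q : Fin κ → Ideal (𝓞 L)} (hq0 : ∀ k, q k ≠ ⊥)
    (hq : Pairwise fun i j => IsCoprime (q i) (q j)) (hIq : ∀ k, IsCoprime I (q k))
    (leader : I ⧸ shaping I q → I) (S : Finset (Fin κ))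
    (v : (k : Fin κ) → Fin n → 𝓞 L ⧸ q k) :
    (detValues (periodic ι σ γ I q (subcode ι σ γ I q hq hIq leader S v))).Nonempty := by
  have hne : I * ∏ k, q k ≠ ⊥ :=
    mul_ne_zero hI0 (Finset.prod_ne_zero_iff.2 fun k _ => hq0 k)
  -- Two points of one translate of the shaping lattice already give a value, whatever the messages.
  obtain ⟨a, ha, ha0⟩ := Submodule.exists_mem_ne_zero_of_ne_bot hne
  let z : Fin n → 𝓞 L := fun _ => a
  have hz : z ≠ 0 := fun h => ha0 (congrFun h ⟨0, by omega⟩)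
  obtain ⟨D, hD, hD0, -⟩ := exists_det_codeword_eq_natCast h2 hn0 hn σ hσ γ hγ ι z
  have hz' : codeword ι σ γ z ≠ 0 := by
    intro h
    have : Nonempty (Fin n) := ⟨⟨0, by omega⟩⟩
    rw [h, zero_mul, Matrix.det_zero] at hD
    exact (hD0 hz).ne (by exact_mod_cast hD)
  refine ⟨D, codeword ι σ γ (layers I q hq hIq leader v) + codeword ι σ γ z,
    ⟨_, ⟨v, fun _ _ => rfl, rfl⟩, _, ⟨z, fun _ => ha, rfl⟩, rfl⟩,
    codeword ι σ γ (layers I q hq hIq leader v) + codeword ι σ γ 0,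
    ⟨_, ⟨v, fun _ _ => rfl, rfl⟩, _, ⟨0, fun _ => zero_mem _, rfl⟩, rfl⟩, ?_, ?_⟩
  · rw [codeword_zero]
    simpa using hz'
  · rw [codeword_zero, add_zero, add_sub_cancel_left, hD, Complex.ofReal_natCast]

/-- The value is a positive integer divisible by `N(I ∏_{s ∈ S} 𝔮_s)`. Integrality makes the minimum
exist, and divisibility bounds it below. -/
theorem exists_natCast_of_mem_detValues_subcode [IsTotallyComplex K]
    (h2 : Module.finrank ℚ K = 2) [IsGalois K L] {n κ : ℕ} (hn0 : 1 < n)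
    (hn : Module.finrank K L = n)
    (σ : L ≃ₐ[K] L) (hσ : ∀ τ : L ≃ₐ[K] L, τ ∈ Subgroup.zpowers σ)
    (γ : 𝓞 K) (hγ : ∀ j : ℕ, 0 < j → j < n → ∀ y : L, Algebra.norm K y ≠ (γ : K) ^ j)
    (ι : L →+* ℂ) {I : Ideal (𝓞 L)} {q : Fin κ → Ideal (𝓞 L)}
    (hq : Pairwise fun i j => IsCoprime (q i) (q j)) (hIq : ∀ k, IsCoprime I (q k))
    {leader : I ⧸ shaping I q → I} (hleader : ∀ c, (shaping I q).mkQ (leader c) = c)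
    (S : Finset (Fin κ)) (v : (k : Fin κ) → Fin n → 𝓞 L ⧸ q k) {d : ℝ}
    (hd : d ∈ detValues (periodic ι σ γ I q (subcode ι σ γ I q hq hIq leader S v))) :
    ∃ D : ℕ, (D : ℝ) = d ∧ 0 < D ∧ Ideal.absNorm I * Ideal.absNorm (∏ s ∈ S, q s) ≤ D := by
  obtain ⟨X, hX, X', hX', hne, hd⟩ := hd
  obtain ⟨z, hz, hsub⟩ := exists_sub_eq_codeword ι σ γ I q hq hIq hleader S v hX hX'
  have hz0 : z ≠ 0 := by
    rintro rfl
    rw [codeword_zero] at hsub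
    exact hne (sub_eq_zero.1 hsub)
  obtain ⟨D, hD, hD0, hJ⟩ := exists_det_codeword_eq_natCast h2 hn0 hn σ hσ γ hγ ι z
  refine ⟨D, ?_, hD0 hz0, ?_⟩
  · rw [hsub, hD] at hd
    exact_mod_cast hd.symm
  · rw [← map_mul]
    exact Nat.le_of_dvd (hD0 hz0) (hJ _ hz)

theorem norm_mem_detValues_codebook [IsTotallyComplex K] (h2 : Module.finrank ℚ K = 2)
    [IsGalois K L] {n κ : ℕ} (hn : Module.finrank K L = n)
    (σ : L ≃ₐ[K] L) (hσ : ∀ τ : L ≃ₐ[K] L, τ ∈ Subgroup.zpowers σ)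
    (γ : 𝓞 K) (ι : L →+* ℂ) {I : Ideal (𝓞 L)} {q : Fin κ → Ideal (𝓞 L)}
    (hq : Pairwise fun i j => IsCoprime (q i) (q j)) (hIq : ∀ k, IsCoprime I (q k))
    {leader : I ⧸ shaping I q → I} (hleader : ∀ c, (shaping I q).mkQ (leader c) = c)
    {a : 𝓞 L} (ha : a ∈ I) (ha0 : a ≠ 0) :
    ((Algebra.norm ℚ (a : L) : ℚ) : ℝ) ∈
      detValues (periodic ι σ γ I q (codebook n ι σ γ I q hq hIq leader)) := by
  have : FiniteDimensional K L := Module.Finite.of_restrictScalars_finite ℚ K L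
  obtain ⟨k, rfl⟩ : ∃ k, n = k + 1 :=
    ⟨n - 1, by have := Module.finrank_pos (R := K) (M := L); omega⟩
  have hdet := det_codeword_single h2 hn σ hσ γ ι a
  refine ⟨_, codeword_mem_periodic_codebook ι σ γ I q hq hIq hleader
    (x := Pi.single 0 a) fun l => ?_, _,
    codeword_mem_periodic_codebook ι σ γ I q hq hIq hleader (x := 0) fun l => zero_mem _, ?_, ?_⟩
  · rcases eq_or_ne l 0 with rfl | h
    · simpa using ha
    · simp [h]
  · rw [codeword_zero]
    intro h
    rw [h, zero_mul, Matrix.det_zero] at hdet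
    have h0 : Algebra.norm ℚ (a : L) = 0 := by exact_mod_cast hdet.symm
    exact ha0 (RingOfIntegers.ext (Algebra.norm_eq_zero_iff.1 h0))
  · rw [codeword_zero, sub_zero, hdet]

end MinimumDeterminant

end LSTIC

theorem theorem2
    {K L : Type*} [Field K] [NumberField K] [Field L] [NumberField L] [Algebra K L]
    -- the base field is `ℚ(i)` or `ℚ(ω)`
    (hK : IsCyclotomicExtension {4} ℚ K ∨ IsCyclotomicExtension {3} ℚ K)
    -- `L/K` is cyclic of degree `n`, with Galois group generated by `σ`
    [IsGalois K L] (n : ℕ) (hn : Module.finrank K L = n)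
    (σ : L ≃ₐ[K] L) (hσ : ∀ τ : L ≃ₐ[K] L, τ ∈ Subgroup.zpowers σ)
    -- none of `γ, …, γ ^ (n - 1)` is a norm from `L`
    (γ : 𝓞 K) (hγ : ∀ j : ℕ, 0 < j → j < n → ∀ y : L, Algebra.norm K y ≠ (γ : K) ^ j)
    -- entries of codewords are read in `ℂ`
    (ι : L →+* ℂ)
    (I : Ideal (𝓞 L)) (hI : ¬ Submodule.IsPrincipal I)
    (κ : ℕ) (q : Fin κ → Ideal (𝓞 L))
    (hq : Pairwise fun i j => IsCoprime (q i) (q j))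
    (hIq : ∀ k, IsCoprime I (q k))
    -- a complete set of coset leaders of `I/I𝔮`
    (leader : I ⧸ LSTIC.shaping I q → I)
    (hleader : ∀ c, (LSTIC.shaping I q).mkQ (leader c) = c) :
    -- the minimum in `γ_I` exists, and `γ_I` is negative
    IsLeast (LSTIC.normValues I) (sInf (LSTIC.normValues I)) ∧
    LSTIC.gammaI I < 0 ∧
    -- the minimum determinant of the code exists and is positive
    (IsLeast
        (LSTIC.detValues (LSTIC.periodic ι σ γ I q (LSTIC.codebook n ι σ γ I q hq hIq leader)))
        (LSTIC.minDet (LSTIC.periodic ι σ γ I q (LSTIC.codebook n ι σ γ I q hq hIq leader))) ∧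
      0 < LSTIC.minDet (LSTIC.periodic ι σ γ I q (LSTIC.codebook n ι σ γ I q hq hIq leader))) ∧
    ∀ (S : Finset (Fin κ)) (v : (k : Fin κ) → Fin n → 𝓞 L ⧸ q k),
      -- so does that of the subcode for the side information `v_s`, `s ∈ S`
      IsLeast
        (LSTIC.detValues (LSTIC.periodic ι σ γ I q (LSTIC.subcode ι σ γ I q hq hIq leader S v)))
        (LSTIC.minDet (LSTIC.periodic ι σ γ I q (LSTIC.subcode ι σ γ I q hq hIq leader S v))) ∧
      -- the gain is defined when the side information has positive rate
      (0 < LSTIC.sideInfoRate n q S →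
        6 + LSTIC.gammaI I ≤
            LSTIC.gain
              (LSTIC.periodic ι σ γ I q (LSTIC.codebook n ι σ γ I q hq hIq leader))
              (LSTIC.periodic ι σ γ I q (LSTIC.subcode ι σ γ I q hq hIq leader S v))
              (LSTIC.sideInfoRate n q S) ∧
        20 * Real.logb 10 2 + LSTIC.gammaI I ≤
            LSTIC.gain
              (LSTIC.periodic ι σ γ I q (LSTIC.codebook n ι σ γ I q hq hIq leader))
              (LSTIC.periodic ι σ γ I q (LSTIC.subcode ι σ γ I q hq hIq leader S v))
              (LSTIC.sideInfoRate n q S)) := by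
  have hPID := LSTIC.isPrincipalIdealRing_of_cyclotomic hK
  have hTC := LSTIC.isTotallyComplex_of_cyclotomic hK
  have h2 := LSTIC.finrank_eq_two_of_cyclotomic hK
  have : FiniteDimensional K L := Module.Finite.of_restrictScalars_finite ℚ K L
  have hn0 : 1 < n := by
    have hpos : 0 < n := hn ▸ Module.finrank_pos
    refine lt_of_le_of_ne hpos fun h1 => hI ?_
    exact LSTIC.isPrincipal_of_finrank_eq_one (K := K) (hn.trans h1.symm) I
  have hI0 : I ≠ ⊥ := by
    rintro rfl
    exact hI inferInstance
  -- Only the unit ideal is coprime to zero, and `I` is not principal.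
  have hq0 : ∀ k, q k ≠ ⊥ := by
    intro k hk
    have h := hIq k
    rw [hk, ← Ideal.zero_eq_bot, isCoprime_zero_right, Ideal.isUnit_iff] at h
    exact hI (h ▸ inferInstance)
  have hnorm := fun x : 𝓞 L =>
    LSTIC.norm_eq_absNorm_span h2 (ι.comp (algebraMap K L)) x
  obtain ⟨a, haI, ha0⟩ := Submodule.exists_mem_ne_zero_of_ne_bot hI0
  have hleastN : IsLeast (LSTIC.normValues I) (sInf (LSTIC.normValues I)) := by
    refine LSTIC.isLeast_sInf_of_subset_range_natCast ⟨_, a, haI, ha0, rfl⟩ ?_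
    rintro _ ⟨x, -, -, rfl⟩
    exact ⟨_, (hnorm x).symm⟩
  obtain ⟨b, hbI, hb0, hb⟩ := hleastN.1
  have hNI : (0 : ℝ) < Ideal.absNorm I := by
    have : Ideal.absNorm I ≠ 0 := by simpa [Ideal.absNorm_eq_zero_iff] using hI0
    exact_mod_cast Nat.pos_of_ne_zero this
  have hlt : (Ideal.absNorm I : ℝ) < sInf (LSTIC.normValues I) := by
    rw [hb, hnorm]
    exact_mod_cast LSTIC.absNorm_lt_of_not_isPrincipal hI hbI hb0
  have hsub : ∀ (S : Finset (Fin κ)) (v : (k : Fin κ) → Fin n → 𝓞 L ⧸ q k),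
      IsLeast
        (LSTIC.detValues (LSTIC.periodic ι σ γ I q (LSTIC.subcode ι σ γ I q hq hIq leader S v)))
        (LSTIC.minDet
          (LSTIC.periodic ι σ γ I q (LSTIC.subcode ι σ γ I q hq hIq leader S v))) := by
    intro S v
    refine LSTIC.isLeast_sInf_of_subset_range_natCast
      (LSTIC.detValues_subcode_nonempty h2 hn0 hn σ hσ γ hγ ι hI0 hq0 hq hIq leader S v) ?_
    intro d hd
    obtain ⟨D, hD, -⟩ := LSTIC.exists_natCast_of_mem_detValues_subcode h2 hn0 hn σ hσ γ hγ ι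
      hq hIq hleader S v hd
    exact ⟨D, hD⟩
  have hcode : IsLeast
      (LSTIC.detValues (LSTIC.periodic ι σ γ I q (LSTIC.codebook n ι σ γ I q hq hIq leader)))
      (LSTIC.minDet
        (LSTIC.periodic ι σ γ I q (LSTIC.codebook n ι σ γ I q hq hIq leader))) := by
    rw [LSTIC.codebook_eq_subcode]
    exact hsub _ _
  have hpos : 0 < LSTIC.minDet
      (LSTIC.periodic ι σ γ I q (LSTIC.codebook n ι σ γ I q hq hIq leader)) := by
    have h := hcode.1
    rw [LSTIC.codebook_eq_subcode] at h ⊢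
    obtain ⟨D, hD, hD0, -⟩ := LSTIC.exists_natCast_of_mem_detValues_subcode h2 hn0 hn σ hσ γ hγ ι
      hq hIq hleader _ _ h
    rw [← hD]
    exact_mod_cast hD0
  have hle : LSTIC.minDet
      (LSTIC.periodic ι σ γ I q (LSTIC.codebook n ι σ γ I q hq hIq leader)) ≤
        sInf (LSTIC.normValues I) := by
    rw [hb]
    exact hcode.2
      (LSTIC.norm_mem_detValues_codebook h2 hn σ hσ γ ι hq hIq hleader hbI hb0)
  refine ⟨hleastN, ?_, ⟨hcode, hpos⟩, fun S v => ⟨hsub S v, fun hR => ?_⟩⟩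
  · exact mul_neg_of_pos_of_neg (by norm_num)
      (Real.logb_neg (by norm_num) (div_pos hNI (hNI.trans hlt))
        ((div_lt_one (hNI.trans hlt)).2 hlt))
  have hn' : (0 : ℝ) < n := by exact_mod_cast hn0.trans' one_pos
  rw [LSTIC.sideInfoRate_eq (by omega) hq0] at hR ⊢
  have hQ : 2 ≤ Ideal.absNorm (∏ s ∈ S, q s) := by
    by_contra! h
    -- Both values have `Real.logb` equal to `0`, which contradicts a positive rate.
    have h01 : Ideal.absNorm (∏ s ∈ S, q s) = 0 ∨ Ideal.absNorm (∏ s ∈ S, q s) = 1 := by omega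
    rcases h01 with h | h <;> simp [h] at hR
  obtain ⟨D, hD, -, hDle⟩ := LSTIC.exists_natCast_of_mem_detValues_subcode h2 hn0 hn σ hσ γ hγ ι
    hq hIq hleader S v (hsub S v).1
  have hδ : (Ideal.absNorm I : ℝ) * (Ideal.absNorm (∏ s ∈ S, q s) : ℝ) ≤ LSTIC.minDet
      (LSTIC.periodic ι σ γ I q (LSTIC.subcode ι σ γ I q hq hIq leader S v)) := by
    rw [← hD]
    exact_mod_cast hDle
  have hgain := LSTIC.gain_lower_bound hNI hlt.le hpos hle (by exact_mod_cast hQ) hδ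
  have hrate : (n : ℝ) * (Real.logb 2 (Ideal.absNorm (∏ s ∈ S, q s)) / (2 * n)) =
      Real.logb 2 (Ideal.absNorm (∏ s ∈ S, q s)) / 2 := by
    field_simp
  rw [LSTIC.gain, LSTIC.gammaI, hrate]
  exact ⟨(add_le_add_left LSTIC.six_le_logb _).trans hgain, hgain⟩
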